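/- Let $K\subset\mathbb R^n$ be a nonempty compact convex polyhedron, described by linear inequalities $g_1\ge0,\dots,g_s\ge0$, that is, $K=\{x\in\mathbb R^n : g_1(x)\ge0,\dots,g_s(x)\ge0\}$ where $g_1,\dots,g_s\in\mathbb R[x_1,\dots,x_n]$ are polynomials of degree at most $1$. Let $S\subset\mathbb R[x_1,\dots,x_n]$ be the semiring generated by the nonnegative real constants $\mathbb R_+$ and $g_1,\dots,g_s$, i.e. the smallest subset of $\mathbb R[x_1,\dots,x_n]$ that contains $\mathbb R_+$ and all $g_i$ and is closed under addition and multiplication. Let $F$ be a face of $K$, that is, a convex subset of $K$ such that whenever a point of $F$ lies in the open segment between two points of $K$, both of these points belong to $F$ (so $F=\emptyset$ and $F=K$ are allowed). Let $f\in\mathbb R[x_1,\dots,x_n]$ satisfy $f(z)=0$ for all $z\in F$ and $f(y)>0$ for all $y\in K\setminus F$. Assume that for every $z\in F$ and every $y\in K\setminus F$ the directional derivative $$D_{y-z}f(z)=\lim_{t\to0}\frac{f(z+t(y-z))-f(z)}{t}$$ is strictly positive. Then $f\in S$. -/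

import Mathlib

/-- The closed polyhedron of `ℝⁿ` described by the inequalities `g i ≥ 0`. -/
def polyhedronOf {n s : ℕ} (g : Fin s → MvPolynomial (Fin n) ℝ) : Set (Fin n → ℝ) :=
  {x | ∀ i, 0 ≤ MvPolynomial.eval x (g i)}

/-- The subsemiring of `ℝ[x₁, …, xₙ]` generated by the nonnegative real constants and the `g i`. -/
noncomputable def semiringOf {n s : ℕ} (g : Fin s → MvPolynomial (Fin n) ℝ) :
    Subsemiring (MvPolynomial (Fin n) ℝ) :=
  Subsemiring.closure ((MvPolynomial.C '' Set.Ici (0 : ℝ)) ∪ Set.range g)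

/-- `F` is a face of the convex set `K`: a convex subset of `K` such that whenever a point of `F`
lies in the open segment between two points of `K`, both of these points are in `F`.
The empty set and `K` itself are faces of `K`. -/
structure IsFaceOfConvex {n : ℕ} (K F : Set (Fin n → ℝ)) : Prop where
  convex : Convex ℝ F
  isExtreme : IsExtreme ℝ K F

/-!
If `F` is empty, this is Handelman's theorem (`mem_semiringOf_of_pos`): the affine functions
nonnegative on `K` lie in the semiring by Farkas' lemma, so after rescaling the coordinates and the
`g i` embed `K` into a unit cube whose coordinates `t` and `1 - t` lie in the semiring. A polynomial
positive on `K` extends to one positive on the cube, and the Bernstein coefficients of the latter in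
a large degree are positive (`aeval_mem_of_pos_on_cube`).

If `F` is nonempty, let `I` be the set of the inequalities active on all of `F`. Near a point of its
relative interior, `F` is the affine subspace `g i = 0`, `i ∈ I`, so `f` is in the ideal generated
by these `g i` (`exists_eq_sum_mul_of_eventually_eval_eq_zero`). By Handelman's theorem it
suffices to find a representation `f = ∑ i ∈ I, g i * h i` with all `h i` positive on `K`. Such
representations form an affine space over the polynomial ring, so by a partition of unity and the
Stone-Weierstrass theorem (`exists_forall_pos_sum_mul`) it is enough to find one for each point of
`K`, with `h i` positive at this point. Outside `F`, where `f` is positive, Koszul syzygies change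
the values of the `h i` as needed (`exists_sum_mul_pos_of_eval_pos`). At a point of `F` the
condition on the directional derivatives says that the differential of `f` lies in the relative
interior of the cone generated by the differentials of the `g i`, `i ∈ I`, and constant syzygies
suffice (`exists_sum_mul_pos_of_lineDeriv_pos`).
-/

/-! ### Farkas' lemma -/

/-- **Farkas' lemma** for finitely many functionals on a real vector space, by induction on their
number: the new functional `a j` is projected away along a vector violating the inequality. -/
theorem exists_nonneg_sum_of_forall_nonneg {ι V : Type*} [AddCommGroup V] [Module ℝ V]
    (s : Finset ι) (a : ι → V →ₗ[ℝ] ℝ) (b : V →ₗ[ℝ] ℝ)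
    (h : ∀ x, (∀ i ∈ s, 0 ≤ a i x) → 0 ≤ b x) :
    ∃ w : ι → ℝ, (∀ i, 0 ≤ w i) ∧ b = ∑ i ∈ s, w i • a i := by
  classical
  induction s using Finset.induction_on generalizing a b with
  | empty =>
    refine ⟨fun _ => 0, fun _ => le_rfl, ?_⟩
    ext x
    have h1 := h x (by simp)
    have h2 := h (-x) (by simp)
    rw [map_neg] at h2
    simp only [Finset.sum_empty, LinearMap.zero_apply]
    linarith
  | insert j s hj ih =>
    by_cases hb : ∀ x, (∀ i ∈ s, 0 ≤ a i x) → 0 ≤ b x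
    · obtain ⟨w, hw, hwb⟩ := ih a b hb
      refine ⟨Function.update w j 0, fun i => ?_, ?_⟩
      · by_cases hi : i = j <;> simp [hi, hw]
      · rw [Finset.sum_insert hj, Function.update_self, zero_smul, zero_add, hwb]
        refine Finset.sum_congr rfl fun i hi => ?_
        rw [Function.update_of_ne (ne_of_mem_of_not_mem hi hj)]
    · push Not at hb
      obtain ⟨x₀, hx₀, hbx⟩ := hb
      have hjx : a j x₀ < 0 := by
        by_contra hc
        refine absurd (h x₀ fun i hi => ?_) (not_le.2 hbx)
        rcases Finset.mem_insert.1 hi with rfl | hi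
        exacts [not_lt.1 hc, hx₀ i hi]
      -- `x ↦ x - (a j x / a j x₀) x₀` is the projection onto `ker (a j)` along `x₀`.
      obtain ⟨w, hw, hwb⟩ := ih (fun i => a i - (a i x₀ / a j x₀) • a j)
        (b - (b x₀ / a j x₀) • a j) (fun x hx => by
          have := h (x - (a j x / a j x₀) • x₀) (fun i hi => ?_)
          · simp only [map_sub, map_smul, smul_eq_mul, LinearMap.sub_apply,
              LinearMap.smul_apply] at this ⊢
            convert this using 2
            ring
          · rcases Finset.mem_insert.1 hi with rfl | hi
            · simp only [map_sub, map_smul, smul_eq_mul]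
              rw [div_mul_cancel₀ _ hjx.ne, sub_self]
            · have := hx i hi
              simp only [map_sub, map_smul, smul_eq_mul, LinearMap.sub_apply,
                LinearMap.smul_apply] at this ⊢
              convert this using 2
              ring)
      refine ⟨Function.update w j (b x₀ / a j x₀ - ∑ i ∈ s, w i * (a i x₀ / a j x₀)),
        fun i => ?_, ?_⟩
      · by_cases hi : i = j
        · subst hi
          rw [Function.update_self, sub_nonneg]
          exact (Finset.sum_nonpos fun k hk => mul_nonpos_of_nonneg_of_nonpos (hw k)
            (div_nonpos_of_nonneg_of_nonpos (hx₀ k hk) hjx.le)).trans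
            (div_nonneg_of_nonpos hbx.le hjx.le)
        · rw [Function.update_of_ne hi]
          exact hw i
      · have hs : ∑ i ∈ s, Function.update w j
            (b x₀ / a j x₀ - ∑ i ∈ s, w i * (a i x₀ / a j x₀)) i • a i = ∑ i ∈ s, w i • a i :=
          Finset.sum_congr rfl fun i hi => by
            rw [Function.update_of_ne (ne_of_mem_of_not_mem hi hj)]
        rw [Finset.sum_insert hj, Function.update_self, hs]
        ext x
        have := LinearMap.congr_fun hwb x
        simp only [LinearMap.sub_apply, LinearMap.smul_apply, smul_eq_mul, LinearMap.sum_apply,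
          LinearMap.add_apply, mul_sub, Finset.sum_sub_distrib, ← mul_assoc,
          ← Finset.sum_mul] at this ⊢
        linear_combination this

/-- The affine form of Farkas' lemma: an affine function which is nonnegative on a nonempty
polyhedron is a nonnegative combination of the defining inequalities and a nonnegative constant. -/
theorem exists_nonneg_sum_add_of_forall_nonneg {ι V : Type*} [AddCommGroup V] [Module ℝ V]
    (s : Finset ι) (a : ι → V →ₗ[ℝ] ℝ) (c : ι → ℝ) (b : V →ₗ[ℝ] ℝ) (d : ℝ)
    (hne : ∃ x, ∀ i ∈ s, 0 ≤ a i x + c i)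
    (h : ∀ x, (∀ i ∈ s, 0 ≤ a i x + c i) → 0 ≤ b x + d) :
    ∃ (w : ι → ℝ) (e : ℝ), (∀ i, 0 ≤ w i) ∧ 0 ≤ e ∧ b = ∑ i ∈ s, w i • a i ∧
      d = ∑ i ∈ s, w i * c i + e := by
  classical
  -- Homogenize: `none` stands for the inequality `t ≥ 0`.
  obtain ⟨w, hw, hwb⟩ := exists_nonneg_sum_of_forall_nonneg (V := V × ℝ) (Finset.insertNone s)
    (fun o => o.elim (LinearMap.snd ℝ V ℝ)
      fun i => (a i).comp (LinearMap.fst ℝ V ℝ) + c i • LinearMap.snd ℝ V ℝ)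
    (b.comp (LinearMap.fst ℝ V ℝ) + d • LinearMap.snd ℝ V ℝ) (by
      rintro ⟨v, t⟩ hvt
      have ht : 0 ≤ t := by simpa using hvt none (by simp)
      have hv : ∀ i ∈ s, 0 ≤ a i v + c i * t := fun i hi => by
        simpa using hvt (some i) (by simpa using hi)
      simp only [LinearMap.add_apply, LinearMap.comp_apply, LinearMap.fst_apply,
        LinearMap.smul_apply, LinearMap.snd_apply, smul_eq_mul]
      rcases ht.eq_or_lt with rfl | ht
      · -- For `t = 0` the vector `v` is a direction of recession of the polyhedron.
        obtain ⟨x, hx⟩ := hne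
        by_contra hneg
        have hneg : b v < 0 := by simpa using hneg
        obtain ⟨N, hN⟩ := exists_nat_gt ((b x + d) / (-b v))
        rw [div_lt_iff₀ (by linarith)] at hN
        have := h (x + (N : ℝ) • v) (fun i hi => by
          have h1 := hx i hi
          have h2 : 0 ≤ a i v := by simpa using hv i hi
          have h3 : 0 ≤ (N : ℝ) * a i v := by positivity
          simp only [map_add, map_smul, smul_eq_mul]
          linarith)
        simp only [map_add, map_smul, smul_eq_mul] at this
        linarith
      · have := h (t⁻¹ • v) (fun i hi => by
          have := mul_nonneg (inv_nonneg.2 ht.le) (hv i hi)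
          rw [map_smul, smul_eq_mul]
          rwa [mul_add, mul_left_comm, inv_mul_cancel₀ ht.ne', mul_one] at this)
        rw [map_smul, smul_eq_mul] at this
        have := mul_nonneg ht.le this
        rwa [mul_add, mul_inv_cancel_left₀ ht.ne', mul_comm t d] at this)
  refine ⟨fun i => w (some i), w none, fun i => hw _, hw _, ?_, ?_⟩
  · ext v
    have := LinearMap.congr_fun hwb (v, 0)
    simpa [Finset.sum_insertNone] using this
  · have := LinearMap.congr_fun hwb (0, 1)
    simpa [Finset.sum_insertNone, add_comm] using this

/-! ### Affine polynomials -/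

open MvPolynomial in
/-- The polynomial whose value at `x` is `L x + c`. -/
noncomputable def affinePoly {n : ℕ} (L : (Fin n → ℝ) →ₗ[ℝ] ℝ) (c : ℝ) :
    MvPolynomial (Fin n) ℝ :=
  ∑ k, C (L (Pi.single k 1)) * X k + C c

section

open MvPolynomial

variable {n : ℕ}

@[simp]
theorem eval_affinePoly (L : (Fin n → ℝ) →ₗ[ℝ] ℝ) (c : ℝ) (x : Fin n → ℝ) :
    eval x (affinePoly L c) = L x + c := by
  conv_rhs => rw [LinearMap.pi_apply_eq_sum_univ L x]
  simp [affinePoly, mul_comm]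
  refine Finset.sum_congr rfl fun k _ => ?_
  congr 2
  ext i
  simp [Pi.single_apply, eq_comm]

theorem exists_eq_affinePoly {p : MvPolynomial (Fin n) ℝ} (hp : p.totalDegree ≤ 1) :
    ∃ L c, p = affinePoly L c := by
  classical
  refine ⟨∑ k, coeff (Finsupp.single k 1) p • LinearMap.proj k, coeff 0 p, ?_⟩
  ext m
  simp only [affinePoly, coeff_add, coeff_sum, coeff_C_mul, coeff_X, coeff_C]
  rcases Nat.lt_or_ge 1 m.degree with h | h
  · rw [coeff_eq_zero_of_totalDegree_lt (lt_of_le_of_lt hp h), Finset.sum_eq_zero, if_neg, add_zero]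
    · rintro rfl
      simp at h
    · intro k _
      rw [if_neg, mul_zero]
      rintro rfl
      simp at h
  · rcases Nat.le_one_iff_eq_zero_or_eq_one.1 h with h | h
    · rw [Finsupp.degree_eq_zero_iff] at h
      subst h
      simp
    · obtain ⟨k, rfl⟩ := (Finsupp.sum_eq_one_iff m).1 h
      rw [if_neg (fun h => by simpa using h.symm), add_zero, Finset.sum_eq_single k]
      · simp [Pi.single_apply]
      · intro b _ hb
        rw [if_neg, mul_zero]
        exact fun h => hb (Finsupp.single_left_injective one_ne_zero h)
      · simp

theorem affinePoly_sum {ι : Type*} (s : Finset ι) (w : ι → ℝ)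
    (L : ι → (Fin n → ℝ) →ₗ[ℝ] ℝ) (c : ι → ℝ) (e : ℝ) :
    affinePoly (∑ i ∈ s, w i • L i) (∑ i ∈ s, w i * c i + e) =
      ∑ i ∈ s, C (w i) * affinePoly (L i) (c i) + C e := by
  refine funext fun x => ?_
  simp [mul_add, Finset.sum_add_distrib, add_assoc]

end

/-! ### Bernstein coefficients on the unit cube -/

section

open Finset

/-- The factor `∏_{i<k} (t - iε) / (1 - iε)`, a deformation of `t ^ k`. For `ε = 1 / N` and
`t = j / N` it is the coefficient of `(N choose j) y ^ j (1 - y) ^ (N - j)` in the expansion of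
`y ^ k` in the Bernstein basis of degree `N`. -/
noncomputable def bernsteinCoeff (ε : ℝ) (k : ℕ) (t : ℝ) : ℝ :=
  ∏ i ∈ range k, (t - i * ε) / (1 - i * ε)

theorem choose_mul_prod_div (k M m : ℕ) :
    ((M + k).choose (m + k) : ℝ) *
      ∏ i ∈ range k, (((m + k : ℕ) : ℝ) - i) / (((M + k : ℕ) : ℝ) - i) = M.choose m := by
  induction k generalizing M m with
  | zero => simp
  | succ k ih =>
    have h := ih (M + 1) (m + 1)
    rw [prod_range_succ, ← mul_assoc, show M + (k + 1) = M + 1 + k by ring,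
      show m + (k + 1) = m + 1 + k by ring, h]
    have hc : ((M : ℝ) + 1) * M.choose m = (M + 1).choose (m + 1) * (m + 1) := by
      exact_mod_cast Nat.add_one_mul_choose_eq M m
    have hM : (M : ℝ) + 1 ≠ 0 := by positivity
    push_cast
    rw [add_sub_cancel_right, add_sub_cancel_right, mul_div_assoc', ← hc,
      mul_div_cancel_left₀ _ hM]

theorem bernsteinCoeff_inv {N : ℕ} (hN : N ≠ 0) (k j : ℕ) :
    bernsteinCoeff (N : ℝ)⁻¹ k (j * (N : ℝ)⁻¹) = ∏ i ∈ range k, ((j : ℝ) - i) / ((N : ℝ) - i) := by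
  refine prod_congr rfl fun i _ => ?_
  have hN : (N : ℝ) ≠ 0 := by exact_mod_cast hN
  rw [← mul_div_mul_right ((j : ℝ) - i) _ (inv_ne_zero hN), sub_mul, sub_mul, mul_inv_cancel₀ hN]

/-- The expansion of `y ^ k` in the Bernstein basis of degree `N ≥ k`. -/
theorem pow_eq_sum_bernsteinCoeff {A : Type*} [CommRing A] [Algebra ℝ A] (y : A) {k N : ℕ}
    (hN : N ≠ 0) (hk : k ≤ N) :
    y ^ k = ∑ j ∈ range (N + 1), algebraMap ℝ A (bernsteinCoeff (N : ℝ)⁻¹ k (j * (N : ℝ)⁻¹)) *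
      (N.choose j * y ^ j * (1 - y) ^ (N - j)) := by
  obtain ⟨M, rfl⟩ := Nat.exists_eq_add_of_le' hk
  have hlow : ∀ j ∈ range k, algebraMap ℝ A
      (bernsteinCoeff ((M + k : ℕ) : ℝ)⁻¹ k (j * ((M + k : ℕ) : ℝ)⁻¹)) *
      ((M + k).choose j * y ^ j * (1 - y) ^ (M + k - j)) = 0 := by
    intro j hj
    rw [bernsteinCoeff_inv hN, prod_eq_zero hj (by simp), map_zero, zero_mul]
  rw [show M + k + 1 = k + (M + 1) by ring, sum_range_add, sum_eq_zero hlow, zero_add]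
  calc y ^ k = y ^ k * (y + (1 - y)) ^ M := by simp
    _ = _ := by
      rw [add_pow, mul_sum]
      refine sum_congr rfl fun m _ => ?_
      have h := congrArg (algebraMap ℝ A) (choose_mul_prod_div k M m)
      rw [map_mul, map_natCast, map_natCast] at h
      rw [bernsteinCoeff_inv hN, add_comm k m, ← h, Nat.add_sub_add_right]
      ring

open Filter Topology MvPolynomial in
/-- A polynomial which is positive on the cube `[0, 1] ^ σ` is a polynomial with nonnegative
coefficients in the variables `y i` and `1 - y i`: its Bernstein coefficients of a large degree are
close to its values. -/
theorem aeval_mem_of_pos_on_cube {σ A : Type*} [Fintype σ] [CommRing A] [Algebra ℝ A]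
    (T : Subsemiring A) (hT : ∀ c : ℝ, 0 ≤ c → algebraMap ℝ A c ∈ T) (y : σ → A)
    (hy : ∀ i, y i ∈ T) (hy' : ∀ i, 1 - y i ∈ T) (p : MvPolynomial σ ℝ)
    (hp : ∀ t : σ → ℝ, (∀ i, t i ∈ Set.Icc (0 : ℝ) 1) → 0 < eval t p) : aeval y p ∈ T := by
  classical
  let c : ℝ → (σ → ℝ) → ℝ := fun ε t =>
    ∑ α ∈ p.support, p.coeff α * ∏ i, bernsteinCoeff ε (α i) (t i)
  have hc : ∀ᶠ ε in 𝓝 (0 : ℝ), ∀ t ∈ Set.pi Set.univ fun _ : σ => Set.Icc (0 : ℝ) 1,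
      0 < c ε t := by
    refine (isCompact_univ_pi fun _ => isCompact_Icc).eventually_forall_of_forall_eventually
      fun t ht => ?_
    have h0 : c 0 t = eval t p := by
      simp [c, eval_eq', bernsteinCoeff]
    have hcont : ContinuousAt (fun z : ℝ × (σ → ℝ) => c z.1 z.2) (0, t) := by
      refine tendsto_finsetSum _ fun α _ => tendsto_const_nhds.mul <|
        tendsto_finsetProd _ fun i _ => tendsto_finsetProd _ fun m _ => ?_
      exact ContinuousAt.div (by fun_prop) (by fun_prop) (by simp)
    refine hcont.eventually_const_lt ?_
    show 0 < c 0 t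
    rw [h0]
    exact hp t fun i => ht i (Set.mem_univ i)
  have hinv : Tendsto (fun N : ℕ => (N : ℝ)⁻¹) atTop (𝓝 0) := tendsto_inv_atTop_nhds_zero_nat
  obtain ⟨N, hcN, hN, hdN⟩ := ((hinv.eventually hc).and
    ((eventually_ne_atTop 0).and (eventually_ge_atTop p.totalDegree))).exists
  have key : aeval y p = ∑ j ∈ Fintype.piFinset fun _ : σ => range (N + 1),
      algebraMap ℝ A (c (N : ℝ)⁻¹ fun i => j i * (N : ℝ)⁻¹) *
        ∏ i, ((N.choose (j i) : A) * y i ^ j i * (1 - y i) ^ (N - j i)) := by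
    simp only [c, map_sum, map_mul, map_prod, sum_mul]
    rw [sum_comm, aeval_def, eval₂_eq']
    refine sum_congr rfl fun α hα => ?_
    have hα' : ∀ i, α i ≤ N := fun i =>
      ((Finsupp.le_degree i α).trans (le_totalDegree hα)).trans hdN
    simp_rw [fun i => pow_eq_sum_bernsteinCoeff (y i) hN (hα' i)]
    rw [prod_univ_sum, mul_sum]
    refine sum_congr rfl fun j _ => ?_
    rw [prod_mul_distrib, mul_assoc]
  rw [key]
  refine sum_mem fun j hj => mul_mem (hT _ (hcN _ fun i _ => ⟨by positivity, ?_⟩).le)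
    (prod_mem fun i _ => mul_mem (mul_mem (natCast_mem _ _) (pow_mem (hy i) _))
      (pow_mem (hy' i) _))
  have hji : j i ≤ N := Nat.lt_succ_iff.1 (mem_range.1 (Fintype.mem_piFinset.1 hj i))
  have hN' : (0 : ℝ) < N := by exact_mod_cast Nat.pos_of_ne_zero hN
  rw [← div_eq_mul_inv, div_le_one hN']
  exact_mod_cast hji

end

/-! ### Polynomials positive on a polytope -/

/-- On a compact set, a function which is positive on the zero set of a nonnegative function `ψ`
becomes positive everywhere after adding a large multiple of `ψ`. -/
theorem IsCompact.exists_forall_pos_add_mul {X : Type*} [TopologicalSpace X] {s : Set X}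
    (hs : IsCompact s) {φ ψ : X → ℝ} (hφ : Continuous φ) (hψ : Continuous ψ)
    (hψ0 : ∀ x ∈ s, 0 ≤ ψ x) (h : ∀ x ∈ s, ψ x = 0 → 0 < φ x) :
    ∃ M : ℝ, ∀ x ∈ s, 0 < φ x + M * ψ x := by
  have hs' : IsCompact (s ∩ {x | φ x ≤ 0}) :=
    hs.inter_right (isClosed_le hφ continuous_const)
  have hpos : ∀ x ∈ s ∩ {x | φ x ≤ 0}, 0 < ψ x := fun x hx =>
    (hψ0 x hx.1).lt_of_ne fun e => absurd (h x hx.1 e.symm) (not_lt.2 hx.2)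
  obtain ⟨M, hM⟩ := hs'.exists_bound_of_continuousOn (f := fun x => φ x / ψ x)
    (hφ.continuousOn.div hψ.continuousOn fun x hx => (hpos x hx).ne')
  refine ⟨|M| + 1, fun x hx => ?_⟩
  by_cases hx0 : φ x ≤ 0
  · have h1 := hpos x ⟨hx, hx0⟩
    have h2 := neg_le_of_abs_le ((hM x ⟨hx, hx0⟩).trans (le_abs_self M))
    rw [le_div_iff₀ h1] at h2
    linarith
  · have := hψ0 x hx
    have : 0 ≤ (|M| + 1) * ψ x := by positivity
    linarith [not_le.1 hx0]

section

open MvPolynomial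

variable {n s : ℕ} {g : Fin s → MvPolynomial (Fin n) ℝ}

theorem C_mem_semiringOf {c : ℝ} (hc : 0 ≤ c) : C c ∈ semiringOf g :=
  Subsemiring.subset_closure (Or.inl ⟨c, hc, rfl⟩)

theorem apply_mem_semiringOf (i : Fin s) : g i ∈ semiringOf g :=
  Subsemiring.subset_closure (Or.inr ⟨i, rfl⟩)

theorem mem_semiringOf_of_totalDegree_le_one (hg : ∀ i, (g i).totalDegree ≤ 1)
    (hne : (polyhedronOf g).Nonempty) {p : MvPolynomial (Fin n) ℝ} (hp : p.totalDegree ≤ 1)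
    (h : ∀ x ∈ polyhedronOf g, 0 ≤ eval x p) : p ∈ semiringOf g := by
  choose A c hAc using fun i => exists_eq_affinePoly (hg i)
  obtain ⟨L, d, rfl⟩ := exists_eq_affinePoly hp
  have hev : ∀ i x, eval x (g i) = A i x + c i := fun i x => by rw [hAc i, eval_affinePoly]
  have hmem : ∀ x, x ∈ polyhedronOf g ↔ ∀ i ∈ Finset.univ, 0 ≤ A i x + c i := fun x => by
    simp [polyhedronOf, hev]
  obtain ⟨w, e, hw, he, rfl, rfl⟩ := exists_nonneg_sum_add_of_forall_nonneg Finset.univ A c L d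
    (hne.imp fun x hx => (hmem x).1 hx)
    (fun x hx => by simpa using h x ((hmem x).2 hx))
  rw [affinePoly_sum]
  refine add_mem (sum_mem fun i _ => mul_mem (C_mem_semiringOf (hw i)) ?_) (C_mem_semiringOf he)
  rw [← hAc i]
  exact apply_mem_semiringOf i

/-- The coordinates `(x k + R) / (2 R)` and `g i / R`. If `R` bounds all `|x k|` and all `g i` on
the polyhedron, they map it into the unit cube. -/
noncomputable def cubeCoord (g : Fin s → MvPolynomial (Fin n) ℝ) (R : ℝ) :
    Fin n ⊕ Fin s → MvPolynomial (Fin n) ℝ :=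
  Sum.elim (fun k => C (2 * R)⁻¹ * (X k + C R)) fun i => C R⁻¹ * g i

/-- A polynomial positive on the polyhedron extends along `cubeCoord` to a polynomial positive on
the whole cube: a large multiple of the squares of the equations `g i = R * t i` of the image
is added. -/
theorem exists_pos_on_cube_aeval_cubeCoord {R : ℝ} (hR : 0 < R)
    {f : MvPolynomial (Fin n) ℝ} (hf : ∀ x ∈ polyhedronOf g, 0 < eval x f) :
    ∃ p : MvPolynomial (Fin n ⊕ Fin s) ℝ,
      (∀ t : Fin n ⊕ Fin s → ℝ, (∀ j, t j ∈ Set.Icc (0 : ℝ) 1) → 0 < eval t p) ∧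
        aeval (cubeCoord g R) p = f := by
  let z : Fin n → MvPolynomial (Fin n ⊕ Fin s) ℝ := fun k => C (2 * R) * X (Sum.inl k) - C R
  have hzt : ∀ (t : Fin n ⊕ Fin s → ℝ) (p : MvPolynomial (Fin n) ℝ),
      eval t (aeval z p) = eval (fun k => 2 * R * t (Sum.inl k) - R) p := fun t p => by
    rw [← coe_aeval_eq_eval, RingHom.coe_coe, comp_aeval_apply, ← coe_aeval_eq_eval,
      RingHom.coe_coe]
    simp [z]
  have hzy : ∀ p, aeval (cubeCoord g R) (aeval z p) = p := fun p => by
    rw [comp_aeval_apply]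
    have : (fun k => aeval (cubeCoord g R) (z k)) = X := by
      funext k
      have h2 : (C (2 * R) * C (2 * R)⁻¹ : MvPolynomial (Fin n) ℝ) = 1 := by
        rw [← C_mul, mul_inv_cancel₀ (by positivity), C_1]
      have : aeval (cubeCoord g R) (z k) = C (2 * R) * (C (2 * R)⁻¹ * (X k + C R)) - C R := by
        simp only [z, cubeCoord, map_sub, map_mul, aeval_X, Sum.elim_inl, algHom_C, algebraMap_eq]
      rw [this, ← mul_assoc, h2, one_mul, add_sub_cancel_right]
    rw [this, aeval_X_left_apply]
  obtain ⟨M, hM⟩ := (isCompact_univ_pi fun _ : Fin n ⊕ Fin s =>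
      isCompact_Icc (a := (0 : ℝ)) (b := 1)).exists_forall_pos_add_mul
    (φ := fun t => eval t (aeval z f))
    (ψ := fun t => eval t (∑ i, (C R * X (Sum.inr i) - aeval z (g i)) ^ 2))
    (continuous_eval _) (continuous_eval _)
    (fun t _ => by
      rw [map_sum]
      exact Finset.sum_nonneg fun i _ => by rw [map_pow]; exact sq_nonneg _)
    (fun t ht h0 => by
      rw [map_sum, Finset.sum_eq_zero_iff_of_nonneg fun i _ => by
        rw [map_pow]; exact sq_nonneg _] at h0
      rw [hzt]
      refine hf _ fun i => ?_
      have := h0 i (Finset.mem_univ i)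
      rw [map_pow, sq_eq_zero_iff, map_sub, hzt, map_mul, eval_C, eval_X] at this
      rw [← sub_eq_zero.1 this]
      exact mul_nonneg hR.le (ht _ (Set.mem_univ _)).1)
  refine ⟨aeval z f + C M * ∑ i, (C R * X (Sum.inr i) - aeval z (g i)) ^ 2, fun t ht => ?_, ?_⟩
  · rw [map_add, map_mul, eval_C]
    exact hM t fun j _ => ht j
  · have hinv : (C R * C R⁻¹ : MvPolynomial (Fin n) ℝ) = 1 := by
      rw [← C_mul, mul_inv_cancel₀ hR.ne', C_1]
    have hzero : aeval (cubeCoord g R) (∑ i, (C R * X (Sum.inr i) - aeval z (g i)) ^ 2) = 0 := by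
      rw [map_sum]
      refine Finset.sum_eq_zero fun i _ => ?_
      rw [map_pow, map_sub, hzy, map_mul, aeval_X, algHom_C, algebraMap_eq, cubeCoord,
        Sum.elim_inr, ← mul_assoc, hinv, one_mul, sub_self, zero_pow two_ne_zero]
    rw [map_add, map_mul, hzero, mul_zero, add_zero, hzy]

theorem exists_bound_of_isCompact_polyhedronOf (hK : IsCompact (polyhedronOf g)) :
    ∃ R : ℝ, 0 < R ∧ (∀ x ∈ polyhedronOf g, ∀ k, |x k| ≤ R) ∧
      ∀ x ∈ polyhedronOf g, ∀ i, eval x (g i) ≤ R := by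
  obtain ⟨R, hR⟩ := hK.exists_bound_of_continuousOn
    (f := fun x => ‖x‖ + ∑ i, eval x (g i)) (by
      have := fun i => continuous_eval (g i)
      fun_prop)
  have hR' : ∀ x ∈ polyhedronOf g, ‖x‖ + ∑ i, eval x (g i) ≤ |R| + 1 := fun x hx =>
    (le_abs_self _).trans ((hR x hx).trans ((le_abs_self R).trans (by linarith)))
  refine ⟨|R| + 1, by positivity, fun x hx k => ?_, fun x hx i => ?_⟩
  · have h1 := norm_le_pi_norm x k
    have h2 : 0 ≤ ∑ i, eval x (g i) := Finset.sum_nonneg fun i _ => hx i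
    rw [Real.norm_eq_abs] at h1
    linarith [hR' x hx]
  · have h1 := Finset.single_le_sum (f := fun i => eval x (g i)) (fun i _ => hx i)
      (Finset.mem_univ i)
    linarith [hR' x hx, norm_nonneg x]

/-- **Handelman's theorem**: a polynomial which is positive on a nonempty polytope lies in the
semiring generated by the nonnegative constants and the defining inequalities. -/
theorem mem_semiringOf_of_pos (hg : ∀ i, (g i).totalDegree ≤ 1)
    (hne : (polyhedronOf g).Nonempty) (hK : IsCompact (polyhedronOf g))
    {f : MvPolynomial (Fin n) ℝ} (hf : ∀ x ∈ polyhedronOf g, 0 < eval x f) :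
    f ∈ semiringOf g := by
  obtain ⟨R, hR, hxR, hgR⟩ := exists_bound_of_isCompact_polyhedronOf hK
  have hdeg : ∀ p : MvPolynomial (Fin n) ℝ, p.totalDegree ≤ 1 → ∀ a b : ℝ,
      (C a * p + C b).totalDegree ≤ 1 := fun p hp a b =>
    (totalDegree_add _ _).trans (max_le ((totalDegree_mul _ _).trans (by simpa using hp))
      (by simp))
  have hbox : ∀ (j : Fin n ⊕ Fin s), (cubeCoord g R j).totalDegree ≤ 1 ∧
      ∀ x ∈ polyhedronOf g, eval x (cubeCoord g R j) ∈ Set.Icc (0 : ℝ) 1 := by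
    rintro (k | i)
    · refine ⟨?_, fun x hx => ?_⟩
      · simpa only [cubeCoord, Sum.elim_inl, mul_add, ← C_mul] using
          hdeg _ (totalDegree_X k).le (2 * R)⁻¹ ((2 * R)⁻¹ * R)
      · have := abs_le.1 (hxR x hx k)
        simp only [cubeCoord, Sum.elim_inl, map_mul, eval_C, map_add, eval_X]
        rw [← div_eq_inv_mul]
        exact ⟨div_nonneg (by linarith) (by linarith), (div_le_one (by linarith)).2 (by linarith)⟩
    · refine ⟨by simpa [cubeCoord] using hdeg _ (hg i) R⁻¹ 0, fun x hx => ?_⟩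
      simp only [cubeCoord, Sum.elim_inr, map_mul, eval_C]
      rw [← div_eq_inv_mul]
      exact ⟨div_nonneg (hx i) hR.le, (div_le_one hR).2 (hgR x hx i)⟩
  obtain ⟨p, hp, rfl⟩ := exists_pos_on_cube_aeval_cubeCoord hR hf
  refine aeval_mem_of_pos_on_cube (semiringOf g) (fun c hc => C_mem_semiringOf hc) _
    (fun j => mem_semiringOf_of_totalDegree_le_one hg hne (hbox j).1
      fun x hx => ((hbox j).2 x hx).1)
    (fun j => mem_semiringOf_of_totalDegree_le_one hg hne
      ((totalDegree_sub _ _).trans (max_le (by simp) (hbox j).1)) fun x hx => ?_) p hp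
  rw [map_sub, map_one, sub_nonneg]
  exact ((hbox j).2 x hx).2

end

/-! ### Gluing local representations -/

section

open MvPolynomial

variable {n : ℕ}

/-- The restriction of polynomial functions to `K`. -/
noncomputable def restrictPoly (K : Set (Fin n → ℝ)) : MvPolynomial (Fin n) ℝ →ₐ[ℝ] C(K, ℝ) :=
  aeval fun k => ⟨fun x => x.1 k, (continuous_apply k).comp continuous_subtype_val⟩

@[simp]
theorem restrictPoly_apply (K : Set (Fin n → ℝ)) (p : MvPolynomial (Fin n) ℝ) (x : K) :
    restrictPoly K p x = eval x.1 p := by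
  induction p using MvPolynomial.induction_on with
  | C a => simp [restrictPoly]
  | add p q hp hq => simp [hp, hq]
  | mul_X p k hp =>
    rw [map_mul, ContinuousMap.mul_apply, hp]
    simp [restrictPoly]

theorem denseRange_restrictPoly (K : Set (Fin n → ℝ)) [CompactSpace K] :
    DenseRange (restrictPoly K) := by
  intro u
  have := ContinuousMap.continuousMap_mem_subalgebra_closure_of_separatesPoints
    (restrictPoly K).range (fun x y hxy => ?_) u
  · rw [← SetLike.mem_coe, Subalgebra.topologicalClosure_coe, AlgHom.coe_range] at this
    exact this
  · obtain ⟨k, hk⟩ := Function.ne_iff.1 (Subtype.coe_injective.ne hxy)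
    exact ⟨_, ⟨restrictPoly K (X k), ⟨X k, rfl⟩, rfl⟩, by simpa using hk⟩

/-- If `f` has near each point of `K` a representation `f = ∑ g i * p i` with positive `p i`, then
it has one with `p i` positive on all of `K`. The representations form an affine space over the
polynomial ring, so they are averaged with polynomial weights of sum `1` which approximate
a partition of unity. -/
theorem exists_forall_pos_sum_mul {ι : Type*} {K : Set (Fin n → ℝ)} (hK : IsCompact K)
    (hne : K.Nonempty) (I : Finset ι) (g : ι → MvPolynomial (Fin n) ℝ)
    (f : MvPolynomial (Fin n) ℝ)
    (h : ∀ x ∈ K, ∃ p : ι → MvPolynomial (Fin n) ℝ,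
      f = ∑ i ∈ I, g i * p i ∧ ∀ i ∈ I, 0 < eval x (p i)) :
    ∃ p : ι → MvPolynomial (Fin n) ℝ,
      f = ∑ i ∈ I, g i * p i ∧ ∀ x ∈ K, ∀ i ∈ I, 0 < eval x (p i) := by
  classical
  have : CompactSpace K := isCompact_iff_compactSpace.1 hK
  choose p hpf hp using fun x : K => h x.1 x.2
  let U : K → Set K := fun x => {y | ∀ i ∈ I, 0 < eval y.1 (p x i)}
  have hU : ∀ x, IsOpen (U x) := fun x => by
    have : U x = ⋂ i ∈ I, {y : K | 0 < eval y.1 (p x i)} := by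
      ext y; simp [U]
    rw [this]
    exact isOpen_biInter_finset fun i _ => isOpen_lt continuous_const
      ((continuous_eval _).comp continuous_subtype_val)
  obtain ⟨t, ht⟩ := CompactSpace.elim_nhds_subcover U fun x => (hU x).mem_nhds (hp x)
  obtain ⟨φ, hφ⟩ := PartitionOfUnity.exists_isSubordinate (isClosed_univ (X := K))
    (fun a : t => U a) (fun a => hU a) (by
      intro y _
      have hy : y ∈ ⋃ x ∈ t, U x := ht ▸ trivial
      obtain ⟨x, hx, hy⟩ := Set.mem_iUnion₂.1 hy
      exact Set.mem_iUnion.2 ⟨⟨x, hx⟩, hy⟩)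
  have hφ1 : ∀ y, ∑ a, φ a y = 1 := fun y => by
    rw [← finsum_eq_sum_of_fintype]
    exact φ.sum_eq_one (Set.mem_univ y)
  have ht0 : (Fintype.card t : ℝ) ≠ 0 := by
    obtain ⟨y⟩ := hne.to_subtype
    intro h0
    have : IsEmpty t := Fintype.card_eq_zero_iff.1 (by exact_mod_cast h0)
    simpa using hφ1 y
  set r : ℝ := (Fintype.card t : ℝ)⁻¹ with hr
  -- The correction by `1 - ∑ q b` gives all families of weights the sum `1`.
  let Ψ : ι → (t → C(K, ℝ)) → C(K, ℝ) := fun i q =>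
    ∑ a, (q a + r • (1 - ∑ b, q b)) * restrictPoly K (p a i)
  have hΨ : ∀ i, Continuous (Ψ i) := fun i => by fun_prop
  have hpos : IsOpen {u : C(K, ℝ) | ∀ y, 0 < u y} := by
    have := ContinuousMap.isOpen_setOfPred_mapsTo (X := K) (Y := ℝ) isCompact_univ
      (isOpen_Ioi (a := 0))
    simpa [Set.MapsTo] using this
  have hO : IsOpen (⋂ i ∈ I, Ψ i ⁻¹' {u | ∀ y, 0 < u y}) :=
    isOpen_biInter_finset fun i _ => hpos.preimage (hΨ i)
  have hφO : (fun a => φ a) ∈ ⋂ i ∈ I, Ψ i ⁻¹' {u | ∀ y, 0 < u y} := by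
    refine Set.mem_iInter₂.2 fun i hi y => ?_
    have hsum : (1 - ∑ b, φ b : C(K, ℝ)) = 0 := by
      ext y
      rw [ContinuousMap.sub_apply, ContinuousMap.sum_apply, hφ1 y]
      simp
    simp only [Ψ, hsum, smul_zero, add_zero, ContinuousMap.sum_apply, ContinuousMap.mul_apply,
      restrictPoly_apply]
    have hnn : ∀ a, 0 ≤ φ a y * eval y.1 (p a i) ∧ (φ a y ≠ 0 → 0 < φ a y * eval y.1 (p a i)) := by
      intro a
      by_cases h0 : φ a y = 0
      · simp [h0]
      · have : 0 < φ a y * eval y.1 (p a i) := mul_pos ((φ.nonneg a y).lt_of_ne' h0)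
          (hφ a (subset_tsupport _ h0) i hi)
        exact ⟨this.le, fun _ => this⟩
    obtain ⟨a, -, ha⟩ := Finset.exists_ne_zero_of_sum_ne_zero
      (show ∑ a, φ a y ≠ 0 by rw [hφ1]; exact one_ne_zero)
    exact Finset.sum_pos' (fun a _ => (hnn a).1) ⟨a, Finset.mem_univ a, (hnn a).2 ha⟩
  obtain ⟨Q, hQ⟩ := (DenseRange.piMap fun _ : t => denseRange_restrictPoly K).exists_mem_open hO
    ⟨_, hφO⟩
  refine ⟨fun i => ∑ a, (Q a + C r * (1 - ∑ b, Q b)) * p a i, ?_, fun x hx i hi => ?_⟩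
  · have hw : ∑ a, (Q a + C r * (1 - ∑ b, Q b)) = 1 := by
      have hcard : (Fintype.card t : MvPolynomial (Fin n) ℝ) * C r = 1 := by
        rw [← map_natCast (C : ℝ →+* MvPolynomial (Fin n) ℝ), ← C_mul, hr, mul_inv_cancel₀ ht0, C_1]
      rw [Finset.sum_add_distrib, Finset.sum_const, Finset.card_univ, nsmul_eq_mul, ← mul_assoc,
        hcard, one_mul, add_sub_cancel]
    calc f = ∑ a, (Q a + C r * (1 - ∑ b, Q b)) * f := by rw [← Finset.sum_mul, hw, one_mul]
      _ = ∑ a : t, (Q a + C r * (1 - ∑ b, Q b)) * ∑ i ∈ I, g i * p a i :=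
        Finset.sum_congr rfl fun a _ => by rw [← hpf a]
      _ = _ := by
        simp only [Finset.mul_sum]
        rw [Finset.sum_comm]
        exact Finset.sum_congr rfl fun i _ => Finset.sum_congr rfl fun a _ => by
          rw [mul_left_comm]
  · have := Set.mem_iInter₂.1 hQ i hi ⟨x, hx⟩
    simpa [Ψ] using this

end

/-! ### Polynomials vanishing on an affine subspace -/

section

open MvPolynomial Filter Topology

variable {n : ℕ} {ι : Type*}

/-- A polynomial vanishing near `z` on an affine subspace through `z` lies in the ideal generated by
the affine equations of the subspace: modulo this ideal it agrees with its composition with a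
projection onto the subspace, which vanishes near `z` and hence is zero. -/
theorem exists_eq_sum_mul_of_eventually_eval_eq_zero (I : Finset ι)
    (L : ι → (Fin n → ℝ) →ₗ[ℝ] ℝ) (c : ι → ℝ) {z : Fin n → ℝ} (hz : ∀ i ∈ I, L i z + c i = 0)
    {f : MvPolynomial (Fin n) ℝ}
    (hf : ∀ᶠ x in 𝓝 z, (∀ i ∈ I, L i x + c i = 0) → eval x f = 0) :
    ∃ p : ι → MvPolynomial (Fin n) ℝ, f = ∑ i ∈ I, affinePoly (L i) (c i) * p i := by
  classical
  let V : Submodule ℝ (Fin n → ℝ) := ⨅ i : I, LinearMap.ker (L i)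
  have hV : ∀ v, v ∈ V ↔ ∀ i ∈ I, L i v = 0 := fun v => by simp [V]
  obtain ⟨π, hπ⟩ := LinearMap.exists_leftInverse_of_injective V.subtype V.ker_subtype
  let P : (Fin n → ℝ) →ₗ[ℝ] (Fin n → ℝ) := V.subtype.comp π
  have hPV : ∀ v, P v ∈ V := fun v => (π v).2
  have hP : ∀ v ∈ V, P v = v := fun v hv =>
    congrArg Subtype.val (LinearMap.congr_fun hπ ⟨v, hv⟩)
  let q : Fin n → MvPolynomial (Fin n) ℝ := fun k =>
    affinePoly ((LinearMap.proj k).comp P) (z k - P z k)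
  have hq : ∀ x, (fun k => eval x (q k)) = z + P (x - z) := fun x => by
    funext k
    simp only [q, eval_affinePoly, LinearMap.comp_apply, LinearMap.proj_apply, map_sub,
      Pi.add_apply, Pi.sub_apply]
    ring
  have hcomp : ∀ x, eval x (aeval q f) = eval (z + P (x - z)) f := fun x => by
    rw [← hq, ← coe_aeval_eq_eval, RingHom.coe_coe, comp_aeval_apply, ← coe_aeval_eq_eval,
      RingHom.coe_coe]
  have hzero : aeval q f = 0 := by
    have hcont : Tendsto (fun x => z + P (x - z)) (𝓝 z) (𝓝 z) := by
      have : Continuous fun x => z + P (x - z) :=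
        continuous_const.add (P.continuous_of_finiteDimensional.comp
          (continuous_id.sub continuous_const))
      simpa using this.tendsto z
    have hev : ∀ᶠ x in 𝓝 z, eval x (aeval q f) = 0 := by
      filter_upwards [hcont.eventually hf] with x hx
      rw [hcomp]
      refine hx fun i hi => ?_
      rw [map_add, (hV _).1 (hPV _) i hi, add_zero]
      exact hz i hi
    obtain ⟨δ, hδ, hball⟩ := Metric.eventually_nhds_iff_ball.1 hev
    refine funext_set (fun k => Metric.ball (z k) δ) (fun k => ?_) fun x hx => ?_
    · rw [Real.ball_eq_Ioo]
      exact Set.Ioo_infinite (by linarith)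
    · rw [map_zero]
      exact hball x (by rwa [ball_pi z hδ])
  let J : Ideal (MvPolynomial (Fin n) ℝ) :=
    Ideal.span ((fun i => affinePoly (L i) (c i)) '' I)
  have hX : ∀ k, X k - q k ∈ J := fun k => by
    have hspan : LinearMap.proj k - (LinearMap.proj k).comp P ∈
        Submodule.span ℝ (Set.range fun i : I => L i) := by
      refine mem_span_of_iInf_ker_le_ker fun v hv => ?_
      have := congrFun (hP v hv) k
      simp [this]
    obtain ⟨w, hw⟩ := (Submodule.mem_span_range_iff_exists_fun ℝ).1 hspan
    have : X k - q k = ∑ i : I, C (w i) * affinePoly (L i) (c i) := by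
      refine MvPolynomial.funext fun x => ?_
      have h1 := LinearMap.congr_fun hw (x - z)
      have h2 := congrFun (hq x) k
      simp only [LinearMap.sum_apply, LinearMap.smul_apply, smul_eq_mul, LinearMap.sub_apply,
        LinearMap.comp_apply, LinearMap.proj_apply, Pi.sub_apply, Pi.add_apply] at h1 h2
      simp only [map_sub, eval_X, map_sum, map_mul, eval_C, eval_affinePoly]
      rw [h2, show x k - (z k + P (x - z) k) = x k - z k - P (x - z) k by ring, ← h1]
      refine Finset.sum_congr rfl fun i _ => ?_
      rw [map_sub, eq_neg_of_add_eq_zero_left (hz i i.2), sub_neg_eq_add]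
    rw [this]
    exact sum_mem fun i _ => Ideal.mul_mem_left _ _ (Ideal.subset_span ⟨i, i.2, rfl⟩)
  have hfJ : f ∈ J := by
    have h1 : Ideal.Quotient.mkₐ ℝ J (aeval q f) = Ideal.Quotient.mkₐ ℝ J (aeval X f) := by
      rw [comp_aeval_apply, comp_aeval_apply]
      congr 2
      funext k
      exact (Ideal.Quotient.eq.2 (hX k)).symm
    rw [hzero, map_zero, aeval_X_left_apply] at h1
    exact Ideal.Quotient.eq_zero_iff_mem.1 h1.symm
  obtain ⟨p, hp⟩ := Submodule.mem_span_image_finset_iff_exists_fun' _ |>.1 hfJ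
  exact ⟨p, by rw [← hp]; simp [mul_comm]⟩

/-! ### Positive representations at a point -/

/-- Changing a representation `f = ∑ g i * p i` by Koszul syzygies makes the `p i` positive at
a point where `f` is positive and the `g i` are nonnegative. -/
theorem exists_sum_mul_pos_of_eval_pos (I : Finset ι) (g p : ι → MvPolynomial (Fin n) ℝ)
    {y : Fin n → ℝ} (hg : ∀ i ∈ I, 0 ≤ eval y (g i))
    (hpos : 0 < eval y (∑ i ∈ I, g i * p i)) :
    ∃ h : ι → MvPolynomial (Fin n) ℝ,
      ∑ i ∈ I, g i * p i = ∑ i ∈ I, g i * h i ∧ ∀ i ∈ I, 0 < eval y (h i) := by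
  set u : ℝ := ∑ i ∈ I, eval y (g i) with hu
  have hu0 : 0 < u := by
    refine (Finset.sum_nonneg hg).lt_of_ne fun h0 => hpos.ne' ?_
    rw [map_sum]
    refine Finset.sum_eq_zero fun i hi => ?_
    rw [map_mul, (Finset.sum_eq_zero_iff_of_nonneg hg).1 h0.symm i hi, zero_mul]
  set a : ℝ := eval y (∑ i ∈ I, g i * p i) / u with ha
  have ha0 : 0 < a := div_pos hpos hu0
  -- `r` is the vector by which the values at `y` have to be changed; it is orthogonal to `g y`.
  let r : ι → ℝ := fun i => eval y (p i) - a
  let G : MvPolynomial (Fin n) ℝ := ∑ i ∈ I, g i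
  let R : MvPolynomial (Fin n) ℝ := ∑ i ∈ I, C (r i) * g i
  have hG : eval y G = u := by simp [G, hu]
  have hR : eval y R = 0 := by
    have : eval y R = eval y (∑ i ∈ I, g i * p i) - a * u := by
      simp only [R, r, map_sum, map_mul, eval_C]
      rw [hu, Finset.mul_sum, ← Finset.sum_sub_distrib]
      exact Finset.sum_congr rfl fun i _ => by ring
    rw [this, ha, div_mul_cancel₀ _ hu0.ne', sub_self]
  refine ⟨fun i => p i - C u⁻¹ * (C (r i) * G - R), ?_, fun i _ => ?_⟩
  · have : ∑ i ∈ I, g i * (C u⁻¹ * (C (r i) * G - R)) = 0 := by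
      calc _ = C u⁻¹ * ((∑ i ∈ I, C (r i) * g i) * G - (∑ i ∈ I, g i) * R) := by
            rw [Finset.sum_mul, Finset.sum_mul, ← Finset.sum_sub_distrib, Finset.mul_sum]
            exact Finset.sum_congr rfl fun i _ => by ring
        _ = 0 := by
            change C u⁻¹ * (R * G - G * R) = 0
            ring
    simp only [mul_sub (g _), Finset.sum_sub_distrib, this, sub_zero]
  · have : eval y (p i - C u⁻¹ * (C (r i) * G - R)) = a := by
      simp only [map_sub, map_mul, eval_C, hG, hR, r]
      field_simp
      ring
    rwa [this]

/-- If a linear combination of the `L i` is positive on the nonzero vectors of the cone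
`{v | ∀ i, 0 ≤ L i v}` modulo its lineality space, it is a combination of the `L i` with positive
coefficients. -/
theorem exists_pos_sum_smul_eq {V : Type*} [AddCommGroup V] [Module ℝ V] (I : Finset ι)
    (L : ι → V →ₗ[ℝ] ℝ) (b : ι → ℝ)
    (h : ∀ v, (∀ i ∈ I, 0 ≤ L i v) → (∃ i ∈ I, 0 < L i v) → 0 < ∑ i ∈ I, b i * L i v) :
    ∃ a : ι → ℝ, (∀ i ∈ I, 0 < a i) ∧ ∀ v, ∑ i ∈ I, b i * L i v = ∑ i ∈ I, a i * L i v := by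
  classical
  -- By Farkas' lemma, `-L i` is a nonnegative combination of the `L j` and of `-∑ b j * L j`.
  have key : ∀ i ∈ I, ∃ (t : ℝ) (w : ι → ℝ), 0 ≤ t ∧ (∀ j, 0 ≤ w j) ∧
      ∀ v, t * ∑ j ∈ I, b j * L j v = L i v + ∑ j ∈ I, w j * L j v := by
    intro i hi
    obtain ⟨w, hw, hwi⟩ := exists_nonneg_sum_of_forall_nonneg (Finset.insertNone I)
      (fun o => o.elim (-∑ j ∈ I, b j • L j) L) (-L i) (fun v hv => by
        have h0 : ∑ j ∈ I, b j * L j v ≤ 0 := by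
          simpa using hv none (by simp)
        have h1 : ∀ j ∈ I, 0 ≤ L j v := fun j hj => by
          simpa using hv (some j) (by simpa using hj)
        by_contra hc
        exact absurd (h v h1 ⟨i, hi, by simpa using hc⟩) (not_lt.2 h0))
    refine ⟨w none, fun j => w (some j), hw _, fun j => hw _, fun v => ?_⟩
    have := LinearMap.congr_fun hwi v
    simp only [Finset.sum_insertNone, Option.elim_none, Option.elim_some, LinearMap.neg_apply,
      LinearMap.add_apply, LinearMap.smul_apply, LinearMap.sum_apply, smul_eq_mul] at this
    linarith
  choose! t w ht hw htw using key
  have hc0 : ∀ j, 1 ≤ 1 + ∑ i ∈ I, w i j := fun j =>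
    le_add_of_nonneg_right (Finset.sum_nonneg fun i hi => hw i hi j)
  have hT : ∀ v, (∑ i ∈ I, t i) * ∑ j ∈ I, b j * L j v =
      ∑ j ∈ I, (1 + ∑ i ∈ I, w i j) * L j v := fun v => by
    rw [Finset.sum_mul, Finset.sum_congr rfl fun i hi => htw i hi v, Finset.sum_add_distrib,
      Finset.sum_comm]
    simp only [add_mul, one_mul, Finset.sum_add_distrib, Finset.sum_mul]
  rcases (Finset.sum_nonneg ht).eq_or_lt with h0 | hpos
  · -- The `L j` satisfy a relation with positive coefficients, a multiple of which is added to `b`.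
    refine ⟨fun j => b j + (1 + ∑ k ∈ I, |b k|) * (1 + ∑ i ∈ I, w i j), fun j hj => ?_,
      fun v => ?_⟩
    · have h1 := Finset.single_le_sum (f := fun k => |b k|) (fun k _ => abs_nonneg (b k)) hj
      have h2 := neg_abs_le (b j)
      have h3 : 1 + ∑ k ∈ I, |b k| ≤ (1 + ∑ k ∈ I, |b k|) * (1 + ∑ i ∈ I, w i j) :=
        le_mul_of_one_le_right (by positivity) (hc0 j)
      linarith
    · have h1 := hT v
      rw [← h0, zero_mul] at h1
      simp only [add_mul (b _), Finset.sum_add_distrib, mul_assoc]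
      rw [← Finset.mul_sum, ← h1, mul_zero, add_zero]
  · refine ⟨fun j => (1 + ∑ i ∈ I, w i j) / ∑ i ∈ I, t i, fun j _ =>
      div_pos (by linarith [hc0 j]) hpos, fun v => ?_⟩
    simp only [div_mul_eq_mul_div]
    rw [← Finset.sum_div, ← hT, mul_div_cancel_left₀ _ hpos.ne']

theorem lineDeriv_eval_sum_mul (I : Finset ι) (L : ι → (Fin n → ℝ) →ₗ[ℝ] ℝ) (c : ι → ℝ)
    (p : ι → MvPolynomial (Fin n) ℝ) {z : Fin n → ℝ} (hz : ∀ i ∈ I, L i z + c i = 0)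
    (v : Fin n → ℝ) :
    lineDeriv ℝ (fun x => eval x (∑ i ∈ I, affinePoly (L i) (c i) * p i)) z v =
      ∑ i ∈ I, eval z (p i) * L i v := by
  let q : ℝ → ℝ := fun t => ∑ i ∈ I, eval (z + t • v) (p i) * L i v
  have hq : Continuous q := continuous_finsetSum _ fun i _ =>
    ((continuous_eval (p i)).comp (by fun_prop)).mul continuous_const
  have hf : (fun t : ℝ => eval (z + t • v) (∑ i ∈ I, affinePoly (L i) (c i) * p i)) =
      fun t => t * q t := by
    funext t
    rw [map_sum, Finset.mul_sum]
    refine Finset.sum_congr rfl fun i hi => ?_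
    rw [map_mul, eval_affinePoly, map_add, map_smul, smul_eq_mul]
    linear_combination (eval (z + t • v) (p i)) * hz i hi
  have h0 : q 0 = ∑ i ∈ I, eval z (p i) * L i v := by simp [q]
  rw [lineDeriv, hf, ← h0]
  refine HasDerivAt.deriv (hasDerivAt_iff_tendsto_slope_zero.2 ?_)
  refine (hq.tendsto 0 |>.mono_left nhdsWithin_le_nhds).congr' ?_
  filter_upwards [self_mem_nhdsWithin] with t ht
  rw [zero_add, zero_mul, sub_zero, smul_eq_mul, inv_mul_cancel_left₀ ht]

end

/-! ### Faces of polyhedra -/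

section

open MvPolynomial Filter Topology

variable {n s : ℕ} {L : Fin s → (Fin n → ℝ) →ₗ[ℝ] ℝ} {c : Fin s → ℝ}

theorem mem_polyhedronOf_affinePoly {x : Fin n → ℝ} :
    x ∈ polyhedronOf (fun i => affinePoly (L i) (c i)) ↔ ∀ i, 0 ≤ L i x + c i := by
  simp [polyhedronOf]

theorem eventually_mem_polyhedronOf_affinePoly {I : Finset (Fin s)} {z : Fin n → ℝ}
    (hz : ∀ i ∉ I, 0 < L i z + c i) :
    ∀ᶠ x in 𝓝 z, (∀ i ∈ I, 0 ≤ L i x + c i) →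
      x ∈ polyhedronOf (fun i => affinePoly (L i) (c i)) := by
  have hev : ∀ᶠ x in 𝓝 z, ∀ i, i ∉ I → 0 < L i x + c i := by
    refine eventually_all.2 fun i => ?_
    by_cases hi : i ∈ I
    · simp [hi]
    · have : Continuous fun x => L i x + c i :=
        (L i).continuous_of_finiteDimensional.add continuous_const
      filter_upwards [(this.tendsto z).eventually_const_lt (hz i hi)] with x hx _ using hx
  filter_upwards [hev] with x hx hI
  refine mem_polyhedronOf_affinePoly.2 fun i => ?_
  by_cases hi : i ∈ I
  exacts [hI i hi, (hx i hi).le]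

/-- A nonempty face `F` of a polyhedron contains a point `z` such that the inequalities active
at `z` are active on all of `F`. It is found by minimizing the number of active inequalities. -/
theorem IsFaceOfConvex.exists_forall_eq_zero {F : Set (Fin n → ℝ)}
    (hF : IsFaceOfConvex (polyhedronOf fun i => affinePoly (L i) (c i)) F) (hne : F.Nonempty) :
    ∃ z ∈ F, ∀ x ∈ F, ∀ i, L i z + c i = 0 → L i x + c i = 0 := by
  classical
  obtain ⟨z, hz, hmin⟩ := (measure fun x : Fin n → ℝ =>
    (Finset.univ.filter fun i => L i x + c i = 0).card).wf.has_min F hne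
  refine ⟨z, hz, fun x hx i hi => ?_⟩
  by_contra hxi
  have hnn : ∀ y ∈ F, ∀ j, 0 ≤ L j y + c j := fun y hy =>
    mem_polyhedronOf_affinePoly.1 (hF.isExtreme.subset hy)
  have hmid : ∀ j, L j ((1 / 2 : ℝ) • z + (1 / 2 : ℝ) • x) + c j =
      (1 / 2) * (L j z + c j) + (1 / 2) * (L j x + c j) := fun j => by
    rw [map_add, map_smul, map_smul, smul_eq_mul, smul_eq_mul]
    ring
  have hmem : (1 / 2 : ℝ) • z + (1 / 2 : ℝ) • x ∈ F :=
    hF.convex hz hx (by norm_num) (by norm_num) (by norm_num)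
  refine hmin _ hmem
    (Finset.card_lt_card ((Finset.ssubset_iff_of_subset fun j hj => ?_).2 ⟨i, ?_, ?_⟩))
  · have h0 := (Finset.mem_filter.1 hj).2
    rw [hmid] at h0
    exact Finset.mem_filter.2 ⟨Finset.mem_univ j, by linarith [hnn z hz j, hnn x hx j]⟩
  · simpa using hi
  · intro hj
    have h0 := (Finset.mem_filter.1 hj).2
    rw [hmid] at h0
    exact hxi (by linarith [hnn z hz i, hnn x hx i])

/-- If `z` lies on a face and the inequalities outside `I` are strict at `z`, then every point of
the polyhedron where the inequalities in `I` are active lies on the face. -/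
theorem IsFaceOfConvex.mem_of_forall_eq_zero {F : Set (Fin n → ℝ)}
    (hF : IsFaceOfConvex (polyhedronOf fun i => affinePoly (L i) (c i)) F)
    {I : Finset (Fin s)} {z : Fin n → ℝ} (hzF : z ∈ F) (hz0 : ∀ i ∈ I, L i z + c i = 0)
    (hz : ∀ i ∉ I, 0 < L i z + c i) {y : Fin n → ℝ}
    (hy : y ∈ polyhedronOf fun i => affinePoly (L i) (c i)) (hy0 : ∀ i ∈ I, L i y + c i = 0) :
    y ∈ F := by
  -- The segment from `y` to `z` is prolonged beyond `z` inside the polyhedron.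
  have hcont : Tendsto (fun ε : ℝ => z + ε • (z - y)) (𝓝[>] 0) (𝓝 z) := by
    have : Continuous fun ε : ℝ => z + ε • (z - y) := by fun_prop
    simpa using (this.tendsto 0).mono_left nhdsWithin_le_nhds
  obtain ⟨ε, hε, hε0⟩ := ((hcont.eventually (eventually_mem_polyhedronOf_affinePoly hz)).and
    self_mem_nhdsWithin).exists
  have hε0 : 0 < ε := hε0
  refine hF.isExtreme.left_mem_of_mem_openSegment hy (hε fun i hi => ?_) hzF
    ⟨ε / (1 + ε), 1 / (1 + ε), by positivity, by positivity,
      by rw [← add_div, add_comm, div_self (by positivity)], ?_⟩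
  · rw [map_add, map_smul, map_sub, smul_eq_mul]
    exact (by linear_combination (1 + ε) * hz0 i hi - ε * hy0 i hi :
      L i z + ε * (L i z - L i y) + c i = 0).ge
  · ext k
    simp only [Pi.add_apply, Pi.smul_apply, Pi.sub_apply, smul_eq_mul]
    field_simp
    ring

/-! ### Positivity with a zero face -/

/-- Let `z` be a point of the relative interior of the face, `I` the set of the inequalities active
there and `f = ∑ i ∈ I, g i * p i`. At a point `y` of the face the differential of `f` is
`∑ i ∈ I, p i y * L i`; the sign condition on the derivatives makes it a combination of the `L i`
with positive coefficients, and the difference of the two combinations is a syzygy of the `g i`. -/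
theorem exists_sum_mul_pos_of_lineDeriv_pos {F : Set (Fin n → ℝ)} {I : Finset (Fin s)}
    {z y : Fin n → ℝ} (hF0 : ∀ x ∈ F, ∀ i ∈ I, L i x + c i = 0)
    (hzF : z ∈ F) (hz : ∀ i ∉ I, 0 < L i z + c i) (hy : y ∈ F)
    (p : Fin s → MvPolynomial (Fin n) ℝ)
    (hD : ∀ x ∈ (polyhedronOf fun i => affinePoly (L i) (c i)) \ F,
      0 < lineDeriv ℝ (fun x => eval x (∑ i ∈ I, affinePoly (L i) (c i) * p i)) y (x - y)) :
    ∃ h : Fin s → MvPolynomial (Fin n) ℝ,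
      ∑ i ∈ I, affinePoly (L i) (c i) * p i = ∑ i ∈ I, affinePoly (L i) (c i) * h i ∧
        ∀ i ∈ I, 0 < eval y (h i) := by
  obtain ⟨a, ha, hab⟩ := exists_pos_sum_smul_eq I L (fun i => eval y (p i)) fun v hv hv' => by
    have hcont : Tendsto (fun ε : ℝ => z + ε • v) (𝓝[>] 0) (𝓝 z) := by
      have : Continuous fun ε : ℝ => z + ε • v := by fun_prop
      simpa using (this.tendsto 0).mono_left nhdsWithin_le_nhds
    obtain ⟨ε, hε, hε0⟩ := ((hcont.eventually (eventually_mem_polyhedronOf_affinePoly hz)).and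
      self_mem_nhdsWithin).exists
    have hε0 : 0 < ε := hε0
    have hval : ∀ i ∈ I, L i (z + ε • v) + c i = ε * L i v := fun i hi => by
      rw [map_add, map_smul, smul_eq_mul]
      linear_combination hF0 z hzF i hi
    have hmem := hε fun i hi => by
      rw [hval i hi]
      exact mul_nonneg hε0.le (hv i hi)
    obtain ⟨j, hj, hvj⟩ := hv'
    have hnot : z + ε • v ∉ F := fun h => by
      have := hF0 _ h j hj
      rw [hval j hj] at this
      exact (mul_pos hε0 hvj).ne' this
    have := hD _ ⟨hmem, hnot⟩
    rw [lineDeriv_eval_sum_mul I L c p (hF0 y hy)] at this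
    have hsum : ∑ i ∈ I, eval y (p i) * L i (z + ε • v - y) =
        ε * ∑ i ∈ I, eval y (p i) * L i v := by
      rw [Finset.mul_sum]
      refine Finset.sum_congr rfl fun i hi => ?_
      rw [map_sub]
      linear_combination (eval y (p i)) * (hval i hi - hF0 y hy i hi)
    rw [hsum] at this
    exact pos_of_mul_pos_right this hε0.le
  refine ⟨fun i => p i + C (a i - eval y (p i)), ?_, fun i hi => by simpa using ha i hi⟩
  have hsyz : ∑ i ∈ I, affinePoly (L i) (c i) * C (a i - eval y (p i)) = 0 := by
    refine MvPolynomial.funext fun x => ?_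
    have h1 := hab (x - y)
    rw [← sub_eq_zero, ← Finset.sum_sub_distrib] at h1
    rw [map_sum, map_zero, ← neg_eq_zero, ← h1, ← Finset.sum_neg_distrib]
    refine Finset.sum_congr rfl fun i hi => ?_
    rw [map_mul, eval_affinePoly, eval_C, map_sub]
    linear_combination (eval y (p i) - a i) * hF0 y hy i hi
  simp only [mul_add, Finset.sum_add_distrib, hsyz, add_zero]

end

theorem mainTheorem3 (n s : ℕ) (g : Fin s → MvPolynomial (Fin n) ℝ)
    (hg : ∀ i, (g i).totalDegree ≤ 1)
    (K : Set (Fin n → ℝ)) (hK : K = polyhedronOf g)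
    (hKne : K.Nonempty) (hKc : IsCompact K)
    (F : Set (Fin n → ℝ)) (hF : IsFaceOfConvex K F)
    (f : MvPolynomial (Fin n) ℝ)
    (hfF : ∀ z ∈ F, MvPolynomial.eval z f = 0)
    (hfK : ∀ y ∈ K \ F, 0 < MvPolynomial.eval y f)
    (hD : ∀ z ∈ F, ∀ y ∈ K \ F,
      0 < lineDeriv ℝ (fun x : Fin n → ℝ => MvPolynomial.eval x f) z (y - z)) :
    f ∈ semiringOf g := by
  classical
  subst hK
  rcases F.eq_empty_or_nonempty with rfl | hFne
  · exact mem_semiringOf_of_pos hg hKne hKc fun x hx => hfK x ⟨hx, id⟩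
  choose L c hLc using fun i => exists_eq_affinePoly (hg i)
  obtain rfl : g = fun i => affinePoly (L i) (c i) := funext hLc
  obtain ⟨z, hzF, hzmin⟩ := hF.exists_forall_eq_zero hFne
  let I : Finset (Fin s) := Finset.univ.filter fun i => L i z + c i = 0
  have hF0 : ∀ x ∈ F, ∀ i ∈ I, L i x + c i = 0 := fun x hx i hi =>
    hzmin x hx i (Finset.mem_filter.1 hi).2
  have hz : ∀ i ∉ I, 0 < L i z + c i := fun i hi =>
    (mem_polyhedronOf_affinePoly.1 (hF.isExtreme.subset hzF) i).lt_of_ne'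
      fun h => hi (Finset.mem_filter.2 ⟨Finset.mem_univ i, h⟩)
  obtain ⟨p, rfl⟩ := exists_eq_sum_mul_of_eventually_eval_eq_zero I L c (hF0 z hzF) (f := f) (by
    filter_upwards [eventually_mem_polyhedronOf_affinePoly hz] with x hx h0
    exact hfF x (hF.mem_of_forall_eq_zero hzF (hF0 z hzF) hz (hx fun i hi => (h0 i hi).ge) h0))
  obtain ⟨h, hh, hpos⟩ := exists_forall_pos_sum_mul hKc hKne I (fun i => affinePoly (L i) (c i))
    (∑ i ∈ I, affinePoly (L i) (c i) * p i) fun x hx => by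
      by_cases hxF : x ∈ F
      · exact exists_sum_mul_pos_of_lineDeriv_pos hF0 hzF hz hxF p (hD x hxF)
      · exact exists_sum_mul_pos_of_eval_pos I _ p (fun i _ => hx i) (hfK x ⟨hx, hxF⟩)
  rw [hh]
  exact sum_mem fun i hi => mul_mem (apply_mem_semiringOf i)
    (mem_semiringOf_of_pos hg hKne hKc fun x hx => hpos x hx i hi)
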